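/- **Setting.** Let $\mathcal A$ be a finite alphabet and let $\sigma$ be an irreducible Pisot substitution over $\mathcal A$ (an endomorphism of the free monoid $\mathcal A^*$ with non-empty images of letters and $|\sigma^k(a)|\to\infty$ for some letter $a$): the characteristic polynomial of the incidence matrix $M_\sigma=(|\sigma(b)|_a)_{a,b}$ is irreducible over $\mathbb Q$ and its dominant root $\alpha$ is a Pisot number. Let $\mathbf v=(v_a)_{a\in\mathcal A}$ be a positive left eigenvector of $M_\sigma$ for $\alpha$ with entries in $K=\mathbb Q(\alpha)\subset\mathbb R$, let $V=\langle v_a : a\in\mathcal A\rangle_{\mathbb Z}$, and put $\delta(w)=\sum_a |w|_a v_a$ for $w\in\mathcal A^*$. Write $b\xrightarrow{p}a$ if $\sigma(b)=pas$ for some $s\in\mathcal A^*$. Let $K_\sigma$ be the product, with the product topology, of the completions of $K$ at all infinite primes other than the one given by the inclusion $K\subset\mathbb R$ and at all finite primes dividing $(\alpha)$, and let $\Phi':K\to K_\sigma$ be the diagonal embedding. For $(x,a)\in K\times\mathcal A$ let $T_\sigma^{-1}(x,a)=\{(\alpha^{-1}(x+\delta(p)),b) : b\xrightarrow{p}a\}$,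 and for $(\gamma,a)\in K_\sigma\times\mathcal A$ let $T_{\rm ext}^{-1}(\gamma,a)=\{(\Phi'(\alpha^{-1})(\gamma+\Phi'(\delta(p))),b) : b\xrightarrow{p}a\}$; both are extended to sets by unions. Let $\mathbb Z_{\sigma,a}\subset K$ be the topological (Kuratowski) limit in $\mathbb R$ of the sets $\alpha^kT_\sigma^{-k}(0,a)$ (first coordinates) as $k\to\infty$. Define the subtiles $\mathcal R_\sigma(a)=\overline{\Phi'(\mathbb Z_{\sigma,a})}$, the central tile $\mathcal R_\sigma=\bigcup_{a\in\mathcal A}\mathcal R_\sigma(a)$, and the translation set $$\Gamma=\{(\Phi'(x),a) : a\in\mathcal A,\ x\in V\cdot\mathbb Z[\alpha^{-1}]\cap[0,\delta(a))\}.$$ The multiple tiling is the family $\{\mathcal R_\sigma(a)+\gamma : (\gamma,a)\in\Gamma\}$. Let $\mathcal U=\{(\mathbf 0,a) : a\in\mathcal A\}$; its tiles make up $\mathcal R_\sigma$. * $\sigma$ satisfies the *geometric property (F)* if $\Gamma=\bigcup_{m\ge0}T_{\rm ext}^{-m}(\mathcal U)$. * $\mathbf 0$ is an *exclusive inner point*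 of $\mathcal R_\sigma$ if $\mathbf 0\in\mathcal R_\sigma$ and $\mathbf 0$ lies in no other tile of the multiple tiling, i.e. $\mathbf 0\notin\mathcal R_\sigma(a)+\gamma$ for all $(\gamma,a)\in\Gamma\setminus\mathcal U$. * $\sigma$ satisfies the *strong coincidence condition* if for all $b_1,b_2\in\mathcal A$ there are $k\in\mathbb N$, $a\in\mathcal A$ and words with $\sigma^k(b_1)=p_1as_1$, $\sigma^k(b_2)=p_2as_2$ such that $p_1,p_2$ have the same abelianisation or $s_1,s_2$ have the same abelianisation. **Lemma.** Let $\sigma$ be an irreducible Pisot substitution that satisfies the strong coincidence condition. Then $\sigma$ satisfies the geometric property (F) if and only if $\mathbf 0$ is an exclusive inner point of the central tile $\mathcal R_\sigma$. -/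

import Mathlib

open Filter Topology NumberField IsDedekindDomain

noncomputable section

namespace PisotSubst

/-! ### Substitutions -/

/-- A substitution over the alphabet `A`: an endomorphism of the free monoid on `A`, given by the
images of the letters. The image of each letter is non-empty, and the length of the iterates of at
least one letter tends to infinity. -/
structure Substitution (A : Type*) where
  image : A → List A
  image_ne_nil : ∀ a, image a ≠ []
  growth : ∃ a, Tendsto (fun k : ℕ => ((fun w : List A => w.flatMap image)^[k] [a]).length)
    atTop atTop

variable {A : Type*} [Fintype A] [DecidableEq A]

/-- The extension of a substitution to finite words. -/
def Substitution.apply (σ : Substitution A) (w : List A) : List A := w.flatMap σ.image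

/-- The abelianisation of a word. -/
def abel (w : List A) : A → ℕ := fun a => w.count a

/-- The incidence matrix: the entry `(a, b)` is the number of occurrences of `a` in `σ(b)`. -/
def Substitution.incidence (σ : Substitution A) : Matrix A A ℕ :=
  Matrix.of fun a b => abel (σ.image b) a

/-- The characteristic polynomial of the incidence matrix, over `ℚ`. -/
def Substitution.charpoly (σ : Substitution A) : Polynomial ℚ :=
  (σ.incidence.map (fun m : ℕ => (m : ℚ))).charpoly

/-- A Pisot number: an algebraic integer `> 1` all of whose other conjugates have modulus `< 1`. -/
def IsPisotNumber (β : ℝ) : Prop :=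
  IsIntegral ℤ β ∧ 1 < β ∧
    ∀ z : ℂ, Polynomial.aeval z (minpoly ℚ β) = 0 → z ≠ (β : ℂ) → ‖z‖ < 1

/-- `β` is the dominant eigenvalue of the incidence matrix. -/
def Substitution.IsDominantEigenvalue (σ : Substitution A) (β : ℝ) : Prop :=
  Polynomial.aeval β σ.charpoly = 0 ∧ ∀ z : ℂ, Polynomial.aeval z σ.charpoly = 0 → ‖z‖ ≤ β

/-- `σ` is an irreducible Pisot substitution with Pisot root `β`. -/
def Substitution.IsIrreduciblePisot (σ : Substitution A) (β : ℝ) : Prop :=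
  Irreducible σ.charpoly ∧ σ.IsDominantEigenvalue β ∧ IsPisotNumber β

/-- The strong coincidence condition. -/
def Substitution.StrongCoincidence (σ : Substitution A) : Prop :=
  ∀ b₁ b₂ : A, ∃ (k : ℕ) (a : A) (p₁ s₁ p₂ s₂ : List A),
    σ.apply^[k] [b₁] = p₁ ++ a :: s₁ ∧ σ.apply^[k] [b₂] = p₂ ++ a :: s₂ ∧
      (abel p₁ = abel p₂ ∨ abel s₁ = abel s₂)

/-- The edge from `b` to `a` with label `p` in the prefix automaton. -/
def Substitution.Edge (σ : Substitution A) (b : A) (p : List A) (a : A) : Prop :=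
  ∃ s : List A, σ.image b = p ++ a :: s

/-! ### The representation space

`K` is the number field generated by the Pisot root `α`, and `τ : K →+* ℝ` is the real embedding
that sends `α` to the Pisot number itself. -/

variable {K : Type*} [Field K] [NumberField K]

/-- The infinite prime given by the real embedding `τ`. -/
def pisotPlace (τ : K →+* ℝ) : InfinitePlace K := InfinitePlace.mk (Complex.ofRealHom.comp τ)

/-- The representation space: the product of the completions of `K` at the infinite primes other
than the one of `τ` and at the finite primes that divide `α`, with the product topology. -/
abbrev RepSpace (τ : K →+* ℝ) (α : K) : Type _ :=
  (∀ w : {w : InfinitePlace K // w ≠ pisotPlace τ}, w.1.Completion) ×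
    (∀ p : {p : HeightOneSpectrum (𝓞 K) // p.valuation K α < 1}, p.1.adicCompletion K)

/-- The diagonal embedding of `K` into the representation space. -/
def Phi' (τ : K →+* ℝ) (α : K) : K →+* RepSpace τ α :=
  RingHom.prod (RingHom.pi fun w => algebraMap K w.1.Completion)
    (RingHom.pi fun p => algebraMap K (p.1.adicCompletion K))

/-! ### Dumont-Thomas numeration -/

/-- `v` is a left eigenvector of the incidence matrix for the eigenvalue `α`, with entries in `K`
that are positive real numbers. -/
def Substitution.IsPosLeftEigenvector (σ : Substitution A) (τ : K →+* ℝ) (α : K) (v : A → K) :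
    Prop :=
  Matrix.vecMul v (σ.incidence.map (fun m : ℕ => (m : K))) = α • v ∧ ∀ a, 0 < τ (v a)

/-- `δ(w)`, the scalar product of the abelianisation of `w` with `v`. -/
def delta (v : A → K) (w : List A) : K := ∑ a, (abel w a : K) * v a

/-- For a ring `R` over `K` (through `ι`), the map that sends `(z, a)` to the set of all
`(α⁻¹ (z + δ(p)), b)`, for the edges from `b` to `a` with label `p` in the prefix automaton,
extended to sets by unions. For `R = K` this is the inverse branch map `T_σ⁻¹`; for `R = K_σ` it is
its extension `T_ext⁻¹`. -/
def Substitution.dualMap {R : Type*} [CommRing R] (σ : Substitution A) (ι : K →+* R) (α : K)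
    (v : A → K) (Y : Set (R × A)) : Set (R × A) :=
  {y | ∃ x ∈ Y, ∃ p : List A, σ.Edge y.2 p x.2 ∧ y.1 = ι α⁻¹ * (x.1 + ι (delta v p))}

/-- The approximations `α^k T_σ^{-k}(0, a)` of the set of `(σ, a)`-integers. -/
def Substitution.approxIntegers (σ : Substitution A) (α : K) (v : A → K) (a : A) (k : ℕ) :
    Set K :=
  {x | ∃ y ∈ (σ.dualMap (RingHom.id K) α v)^[k] {(0, a)}, x = α ^ k * y.1}

/-- The lower (Kuratowski) limit of a sequence of sets; it is the topological limit whenever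
the topological limit exists. -/
def lowerLimit {X : Type*} [TopologicalSpace X] (B : ℕ → Set X) : Set X :=
  {x | ∀ U ∈ 𝓝 x, ∀ᶠ k in atTop, (B k ∩ U).Nonempty}

/-- The `(σ, a)`-integers: the elements of `K` which, as real numbers, lie in the topological
limit of the approximations. -/
def Substitution.integers (σ : Substitution A) (τ : K →+* ℝ) (α : K) (v : A → K) (a : A) :
    Set K :=
  {x | τ x ∈ lowerLimit (fun k => τ '' σ.approxIntegers α v a k)}

/-- `V · ℤ[α⁻¹]`, where `V` is the `ℤ`-module generated by the entries of `v`. -/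
def fracModule (α : K) (v : A → K) : Submodule ℤ K :=
  Submodule.span ℤ (Set.range v) * Subalgebra.toSubmodule (Algebra.adjoin ℤ {α⁻¹})

/-- The `(σ, a)`-fractional parts, `V · ℤ[α⁻¹] ∩ [0, δ(a))`. -/
def frac (τ : K →+* ℝ) (α : K) (v : A → K) (a : A) : Set K :=
  {x | x ∈ fracModule α v ∧ 0 ≤ τ x ∧ τ x < τ (delta v [a])}

/-! ### Tiles, property (F), exclusive inner points -/

/-- The Dumont-Thomas subtile of the letter `a`. -/
def Substitution.subtile (σ : Substitution A) (τ : K →+* ℝ) (α : K) (v : A → K) (a : A) :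
    Set (RepSpace τ α) :=
  closure (Phi' τ α '' σ.integers τ α v a)

/-- The Dumont-Thomas central tile. -/
def Substitution.centralTile (σ : Substitution A) (τ : K →+* ℝ) (α : K) (v : A → K) :
    Set (RepSpace τ α) :=
  ⋃ a, σ.subtile τ α v a

/-- The translation set `Γ`. -/
def translationSet (τ : K →+* ℝ) (α : K) (v : A → K) : Set (RepSpace τ α × A) :=
  {g | ∃ x ∈ frac τ α v g.2, g.1 = Phi' τ α x}

/-- The tile with index `g = (γ, a)`, that is the subtile of `a` translated by `γ`. -/
def Substitution.tile (σ : Substitution A) (τ : K →+* ℝ) (α : K) (v : A → K)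
    (g : RepSpace τ α × A) : Set (RepSpace τ α) :=
  (fun z => z + g.1) '' σ.subtile τ α v g.2

/-- The set `𝓤` of all `(0, a)`; it indexes the subtiles that make up the central tile. -/
def baseSet (A : Type*) (τ : K →+* ℝ) (α : K) : Set (RepSpace τ α × A) :=
  {g | g.1 = 0}

/-- The geometric property (F). -/
def Substitution.GeometricPropertyF (σ : Substitution A) (τ : K →+* ℝ) (α : K) (v : A → K) :
    Prop :=
  translationSet τ α v = ⋃ m : ℕ, (σ.dualMap (Phi' τ α) α v)^[m] (baseSet A τ α)

/-- `η` is an exclusive inner point of the collection of the tiles with index in `C`: it lies in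
one of these tiles and in no other tile of the multiple tiling. -/
def Substitution.IsExclusiveInnerPoint (σ : Substitution A) (τ : K →+* ℝ) (α : K) (v : A → K)
    (η : RepSpace τ α) (C : Set (RepSpace τ α × A)) : Prop :=
  (∃ g ∈ C, η ∈ σ.tile τ α v g) ∧ ∀ g ∈ translationSet τ α v, g ∉ C → η ∉ σ.tile τ α v g

/-- The tiles with index in `𝓤` make up the central tile. -/
theorem Substitution.iUnion_tile_baseSet (σ : Substitution A) (τ : K →+* ℝ) (α : K) (v : A → K) :
    ⋃ g ∈ baseSet A τ α, σ.tile τ α v g = σ.centralTile τ α v := by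
  ext z
  simp only [Set.mem_iUnion, centralTile]
  constructor
  · rintro ⟨⟨γ, a⟩, hg, y, hy, rfl⟩
    have hγ : γ = 0 := hg
    subst hγ
    exact ⟨a, by simpa using hy⟩
  · rintro ⟨a, ha⟩
    exact ⟨(0, a), rfl, z, ha, by simp⟩

/-- `0` is an exclusive inner point of the central tile. -/
def Substitution.ZeroIsExclusiveInnerPoint (σ : Substitution A) (τ : K →+* ℝ) (α : K)
    (v : A → K) : Prop :=
  σ.IsExclusiveInnerPoint τ α v 0 (baseSet A τ α)

end PisotSubst

end

noncomputable section

namespace PisotSubst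

variable {A : Type*} [Fintype A] [DecidableEq A] {K : Type*} [Field K]

/-! ### Word values -/

section Words

variable (v : A → K)

/-! The point `(x, a)` is followed through sums `D = ∑ αⁱ δ(pᵢ)` along paths of the prefix
automaton: the `n`-step inverse branches are `x ↦ α⁻ⁿ (x + D)`. On the real line, the intervals `[D,
D + v_a)` of the length-`n` paths from `b` are disjoint inside `[0, αⁿ v_b)`, so `x + D` determines
`x` and `a` (`pathSums_unique`). In `K_σ`, multiplication by `α` contracts at every place.
Fractional parts with a common denominator and bounded conjugates are finite in number
(`finite_of_bounded`).

(F) gives exclusivity: let `0` lie in the tile of `(Φ'(x), a)`, and approximate `-Φ'(x)` by `Φ'(z)`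
with `z = E + α^M F` an integer for `a`. Then `y = α^{-M}(x + E) = α^{-M}(x + z) - F` lies in a
finite set that does not depend on `M`, provided `z` is close enough. By (F), one `M` can be fixed
in advance that makes `α^M y` a path sum for every `y` in that set. So `x + E` is itself a path sum,
and uniqueness forces `x = 0` (`zero_notMem_tile`).

Exclusivity gives (F): the forward orbit of a fractional part stays in a finite set, so it reaches a
periodic `y` (`exists_periodic`). Periodicity makes `α^{nk} y - y` path sums, and these tend to
`-Φ'(y)`. Hence `0` lies in the tile of `y` (`zero_mem_tile_of_periodic`), and exclusivity forces
`Φ'(y) = 0`. Running back along the orbit reaches `x` from the base set. -/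

lemma delta_nil : delta v ([] : List A) = 0 := by
  simp [delta, abel]

lemma delta_append (p q : List A) : delta v (p ++ q) = delta v p + delta v q := by
  simp [delta, abel, add_mul, Finset.sum_add_distrib]

lemma delta_singleton (a : A) : delta v [a] = v a := by
  simp [delta, abel, List.count_singleton]

lemma delta_cons (a : A) (q : List A) : delta v (a :: q) = v a + delta v q := by
  rw [← List.singleton_append, delta_append, delta_singleton]

lemma Substitution.mul_eq_delta_image [NumberField K] {σ : Substitution A} {τ : K →+* ℝ} {α : K}
    {v : A → K} (hv : σ.IsPosLeftEigenvector τ α v) (b : A) :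
    α * v b = delta v (σ.image b) := by
  have h := congrFun hv.1 b
  simp only [Matrix.vecMul, dotProduct, Matrix.map_apply, Substitution.incidence, Matrix.of_apply,
    Pi.smul_apply, smul_eq_mul] at h
  rw [← h, delta]
  exact Finset.sum_congr rfl fun a _ => mul_comm _ _

variable {v} {τ : K →+* ℝ} (hpos : ∀ a, 0 < τ (v a))
include hpos

lemma map_delta_nonneg (p : List A) : 0 ≤ τ (delta v p) := by
  induction p with
  | nil => simp [delta_nil]
  | cons a q ih => rw [delta_cons, map_add]; linarith [hpos a]

omit hpos in
/-- A real number in `[0, δ(w))` lies in the interval of exactly one letter of `w`. -/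
lemma exists_prefix_of_lt_delta (w : List A) (t : ℝ) (h0 : 0 ≤ t) (h1 : t < τ (delta v w)) :
    ∃ p a s, w = p ++ a :: s ∧ τ (delta v p) ≤ t ∧ t < τ (delta v p) + τ (v a) := by
  induction w generalizing t with
  | nil => simp [delta_nil] at h1; linarith
  | cons c w ih =>
    by_cases hc : t < τ (v c)
    · exact ⟨[], c, w, rfl, by simpa [delta_nil] using h0, by simpa [delta_nil] using hc⟩
    · rw [delta_cons, map_add] at h1
      obtain ⟨p, a, s, rfl, h2, h3⟩ := ih (t - τ (v c)) (by linarith) (by linarith)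
      refine ⟨c :: p, a, s, rfl, ?_, ?_⟩ <;> rw [delta_cons, map_add] <;> linarith

/-- The letters of a word cut the real interval of its value into disjoint half-open pieces. If,
say, `p' = p c q`, then `t = t' + v_c + δ(q)`, which is at least `v_c` under `τ`, against the bound
on `t`. -/
lemma prefix_unique {p s p' s' : List A} {c c' : A} (h : p ++ c :: s = p' ++ c' :: s') {t t' : K}
    (ht : 0 ≤ τ t ∧ τ t < τ (v c)) (ht' : 0 ≤ τ t' ∧ τ t' < τ (v c'))
    (heq : t + delta v p = t' + delta v p') : p = p' ∧ c = c' := by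
  have hτ := congrArg τ heq
  simp only [map_add] at hτ
  rcases List.append_eq_append_iff.1 h with ⟨q, rfl, hq⟩ | ⟨q, rfl, hq⟩
  · rcases q with _ | ⟨d, q⟩
    · simp at hq ⊢; exact hq.1
    · simp only [List.cons_append, List.cons.injEq] at hq
      obtain ⟨rfl, -⟩ := hq
      simp only [delta_append, delta_cons, map_add] at hτ
      linarith [map_delta_nonneg hpos q]
  · rcases q with _ | ⟨d, q⟩
    · simp at hq ⊢; exact hq.1.symm
    · simp only [List.cons_append, List.cons.injEq] at hq
      obtain ⟨rfl, -⟩ := hq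
      simp only [delta_append, delta_cons, map_add] at hτ
      linarith [map_delta_nonneg hpos q]

end Words

/-! ### Digit sums along paths of the prefix automaton -/

/-- The values `∑ αⁱ δ(pᵢ)` of the paths of length `n` from `b` to `a` in the prefix automaton,
where the last edge of the path carries the digit of index `0`. -/
def Substitution.pathSums (σ : Substitution A) (α : K) (v : A → K) : ℕ → A → A → Set K
  | 0, a, b => {D | D = 0 ∧ a = b}
  | n + 1, a, b => {D | ∃ c p, σ.Edge b p c ∧ ∃ E ∈ σ.pathSums α v n a c,
      D = E + α ^ n * delta v p}

section Paths

variable {σ : Substitution A} {α : K} {v : A → K}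

lemma Substitution.pathSums_concat {n m : ℕ} {a b c : A} {D E : K}
    (hD : D ∈ σ.pathSums α v n a c) (hE : E ∈ σ.pathSums α v m c b) :
    D + α ^ n * E ∈ σ.pathSums α v (n + m) a b := by
  induction m generalizing b E with
  | zero =>
    obtain ⟨rfl, rfl⟩ := hE
    simpa using hD
  | succ m ih =>
    obtain ⟨d, p, he, F, hF, rfl⟩ := hE
    exact ⟨d, p, he, _, ih hF, by
      change _ = _ + α ^ (n + m) * _
      ring⟩

lemma Substitution.pathSums_split {n m : ℕ} {a b : A} {D : K}
    (hD : D ∈ σ.pathSums α v (n + m) a b) :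
    ∃ c, ∃ E ∈ σ.pathSums α v n a c, ∃ F ∈ σ.pathSums α v m c b, D = E + α ^ n * F := by
  induction m generalizing b D with
  | zero => exact ⟨b, D, hD, 0, ⟨rfl, rfl⟩, by simp⟩
  | succ m ih =>
    obtain ⟨d, p, he, G, hG, rfl⟩ := hD
    obtain ⟨c, E, hE, F, hF, rfl⟩ := ih hG
    exact ⟨c, E, hE, _, ⟨d, p, he, F, hF, rfl⟩, by
      change _ + α ^ (n + m) * _ = _
      ring⟩

lemma Substitution.Edge.mem_pathSums {a b : A} {p : List A} (h : σ.Edge b p a) :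
    delta v p ∈ σ.pathSums α v 1 a b :=
  ⟨a, p, h, 0, ⟨rfl, rfl⟩, by simp⟩

/-- Closed form of the iterates, for any target ring; it turns statements about the branches on `K`
and on `K_σ` into statements about path sums. -/
lemma Substitution.mem_iterate_dualMap {R : Type*} [CommRing R] (ι : K →+* R) (hα : α ≠ 0)
    (Y : Set (R × A)) (n : ℕ) (y : R × A) :
    y ∈ (σ.dualMap ι α v)^[n] Y ↔
      ∃ x ∈ Y, ∃ D ∈ σ.pathSums α v n x.2 y.2, y.1 = ι (α⁻¹ ^ n) * (x.1 + ι D) := by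
  induction n generalizing y with
  | zero =>
    simp only [Function.iterate_zero, id, pathSums, Set.mem_ofPred_eq, pow_zero, map_one, one_mul]
    constructor
    · intro h
      exact ⟨y, h, 0, ⟨rfl, rfl⟩, by simp⟩
    · rintro ⟨x, hx, D, ⟨rfl, h2⟩, h⟩
      have : y = x := Prod.ext (by simpa using h) h2.symm
      rwa [this]
  | succ n ih =>
    have key : ∀ (u : R) (D : K) (p : List A), ι α⁻¹ * (ι (α⁻¹ ^ n) * (u + ι D) + ι (delta v p))
        = ι (α⁻¹ ^ (n + 1)) * (u + ι (D + α ^ n * delta v p)) := by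
      intro u D p
      have h1 : ι (α⁻¹ ^ n) * ι (α ^ n) = 1 := by
        rw [← map_mul, ← mul_pow, inv_mul_cancel₀ hα, one_pow, map_one]
      rw [pow_succ, map_mul, map_add, map_mul]
      linear_combination (-ι α⁻¹ * ι (delta v p)) * h1
    rw [Function.iterate_succ_apply']
    constructor
    · rintro ⟨z, hz, p, he, hy⟩
      obtain ⟨x, hx, D, hD, hzx⟩ := (ih z).1 hz
      exact ⟨x, hx, _, ⟨z.2, p, he, D, hD, rfl⟩, by rw [hy, hzx, key]⟩
    · rintro ⟨x, hx, _, ⟨c, p, he, D, hD, rfl⟩, hy⟩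
      exact ⟨(_, c), (ih (_, c)).2 ⟨x, hx, D, hD, rfl⟩, p, he, by rw [hy, key]⟩

lemma Substitution.mem_approxIntegers (hα : α ≠ 0) {a : A} {k : ℕ} {x : K} :
    x ∈ σ.approxIntegers α v a k ↔ ∃ b, x ∈ σ.pathSums α v k a b := by
  have key : ∀ D : K, α ^ k * (α⁻¹ ^ k * (0 + D)) = D := fun D => by
    rw [← mul_assoc, ← mul_pow, mul_inv_cancel₀ hα, one_pow, one_mul, zero_add]
  constructor
  · rintro ⟨y, hy, rfl⟩
    obtain ⟨_, rfl, D, hD, h⟩ := (mem_iterate_dualMap _ hα _ _ _).1 hy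
    simp only [RingHom.id_apply] at h
    exact ⟨y.2, by rwa [h, key]⟩
  · rintro ⟨b, hb⟩
    exact ⟨(α⁻¹ ^ k * (0 + x), b), (mem_iterate_dualMap _ hα _ _ _).2 ⟨(0, a), rfl, x, hb, rfl⟩,
      (key x).symm⟩

variable {τ : K →+* ℝ} (hpos : ∀ a, 0 < τ (v a)) (hα : 0 < τ α)
  (hev : ∀ b, α * v b = delta v (σ.image b))
include hpos hα

omit hα in
lemma Substitution.Edge.map_delta_add_le (hev : ∀ b, α * v b = delta v (σ.image b))
    {a b : A} {p : List A} (h : σ.Edge b p a) :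
    τ (delta v p) + τ (v a) ≤ τ α * τ (v b) := by
  obtain ⟨s, hs⟩ := h
  rw [← map_mul, hev, hs, delta_append, delta_cons]
  simp only [map_add]
  linarith [map_delta_nonneg hpos s]

lemma Substitution.pathSums_nonneg {n : ℕ} {a b : A} {D : K} (hD : D ∈ σ.pathSums α v n a b) :
    0 ≤ τ D := by
  induction n generalizing b D with
  | zero => simp [hD.1]
  | succ n ih =>
    obtain ⟨c, p, he, E, hE, rfl⟩ := hD
    have := ih hE
    have := map_delta_nonneg hpos p
    simp only [map_add, map_mul, map_pow]
    positivity

include hev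

/-- `D` is the value of a prefix of `σⁿ(b)` that is followed by `a`, and `σⁿ(b)` has value `αⁿ v_b`.
-/
lemma Substitution.pathSums_add_le {n : ℕ} {a b : A} {D : K} (hD : D ∈ σ.pathSums α v n a b) :
    τ D + τ (v a) ≤ τ α ^ n * τ (v b) := by
  induction n generalizing b D with
  | zero => obtain ⟨rfl, rfl⟩ := hD; simp
  | succ n ih =>
    obtain ⟨c, p, he, E, hE, rfl⟩ := hD
    have h1 := ih hE
    have h2 := mul_le_mul_of_nonneg_left (he.map_delta_add_le hpos hev) (pow_pos hα n).le
    simp only [map_add, map_mul, map_pow]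
    rw [pow_succ]
    linarith

lemma Substitution.pathSums_unique {n : ℕ} {a a' b : A} {D D' x x' : K}
    (hD : D ∈ σ.pathSums α v n a b) (hD' : D' ∈ σ.pathSums α v n a' b)
    (hx : 0 ≤ τ x ∧ τ x < τ (v a)) (hx' : 0 ≤ τ x' ∧ τ x' < τ (v a')) (h : x + D = x' + D') :
    x = x' ∧ a = a' := by
  induction n generalizing b D D' with
  | zero =>
    obtain ⟨rfl, rfl⟩ := hD
    obtain ⟨rfl, rfl⟩ := hD'
    simpa using h
  | succ n ih =>
    obtain ⟨c, p, ⟨s, hs⟩, E, hE, rfl⟩ := hD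
    obtain ⟨c', p', ⟨s', hs'⟩, E', hE', rfl⟩ := hD'
    have hα0 : α ≠ 0 := fun h => by simp [h] at hα
    have hn : 0 < τ α ^ n := pow_pos hα n
    -- Removing the leading digit leaves a remainder in `[0, v_c)` after rescaling, so the leading
    -- digits can be compared inside `σ(b)` alone.
    have aux : ∀ {a c : A} {E x : K}, E ∈ σ.pathSums α v n a c → 0 ≤ τ x ∧ τ x < τ (v a) →
        0 ≤ τ ((x + E) / α ^ n) ∧ τ ((x + E) / α ^ n) < τ (v c) := by
      intro a c E x hE hx
      have h1 := pathSums_nonneg hpos hα hE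
      have h2 := pathSums_add_le hpos hα hev hE
      simp only [map_div₀, map_add, map_pow]
      refine ⟨div_nonneg (by linarith) hn.le, ?_⟩
      rw [div_lt_iff₀ hn]
      linarith
    obtain ⟨rfl, rfl⟩ := prefix_unique hpos (hs.symm.trans hs') (aux hE hx) (aux hE' hx') (by
      field_simp
      linear_combination h)
    exact ih hE hE' (by linear_combination h)

omit hpos in
lemma Substitution.exists_forward (b : A) (x : K) (hx : 0 ≤ τ x ∧ τ x < τ (v b)) :
    ∃ c p, σ.Edge b p c ∧ 0 ≤ τ (α * x - delta v p) ∧ τ (α * x - delta v p) < τ (v c) := by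
  obtain ⟨p, c, s, h, h1, h2⟩ := exists_prefix_of_lt_delta (σ.image b) (τ (α * x))
    (by rw [map_mul]; exact mul_nonneg hα.le hx.1)
    (by rw [← hev, map_mul, map_mul]; exact mul_lt_mul_of_pos_left hx.2 hα)
  refine ⟨c, p, ⟨s, h⟩, ?_, ?_⟩ <;> rw [map_sub] <;> linarith

end Paths

variable [NumberField K]

/-! ### Consequences of irreducibility -/

section Irreducible

variable {σ : Substitution A} {τ : K →+* ℝ} {α : K} {v : A → K}

lemma eq_of_map_eq (hK : IntermediateField.adjoin ℚ {α} = ⊤) (τ : K →+* ℝ) {φ : K →+* ℂ}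
    (h : φ α = τ α) : φ = Complex.ofRealHom.comp τ := by
  have h2 : φ.toRatAlgHom = (Complex.ofRealHom.comp τ).toRatAlgHom := by
    have : ∀ x ∈ IntermediateField.adjoin ℚ {α},
        x ∈ AlgHom.equalizer φ.toRatAlgHom (Complex.ofRealHom.comp τ).toRatAlgHom := by
      intro x hx
      induction hx using IntermediateField.adjoin_induction with
      | mem x hx => obtain rfl := hx; exact h
      | algebraMap x => simp
      | add x y _ _ hx hy => exact add_mem hx hy
      | inv x _ hx =>
        have hx' : φ x = Complex.ofRealHom.comp τ x := hx
        change φ x⁻¹ = Complex.ofRealHom.comp τ x⁻¹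
        rw [map_inv₀, map_inv₀, hx']
      | mul x y _ _ hx hy => exact mul_mem hx hy
    ext x
    exact this x (hK ▸ IntermediateField.mem_top)
  ext x
  exact DFunLike.congr_fun h2 x

lemma minpoly_map_eq (τ : K →+* ℝ) (α : K) : minpoly ℚ (τ α) = minpoly ℚ α :=
  minpoly.algHom_eq τ.toRatAlgHom τ.injective α

/-- The embedding of `w` sends `α` to a conjugate of the Pisot number. That conjugate is a different
one, since an embedding of `K = ℚ(α)` is determined by its value at `α`. -/
lemma infinitePlace_lt_one (hK : IntermediateField.adjoin ℚ {α} = ⊤)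
    (hα : IsPisotNumber (τ α)) {w : InfinitePlace K} (hw : w ≠ pisotPlace τ) : w α < 1 := by
  rw [← InfinitePlace.norm_embedding_eq w α]
  refine hα.2.2 _ ?_ fun h => hw ?_
  · rw [minpoly_map_eq]
    exact (Polynomial.aeval_algHom_apply w.embedding.toRatAlgHom α _).trans
      (by rw [minpoly.aeval, map_zero])
  · rw [← InfinitePlace.mk_embedding w, eq_of_map_eq hK τ h, pisotPlace]

omit [NumberField K] in
lemma isIntegral_of_isPisotNumber (hα : IsPisotNumber (τ α)) : IsIntegral ℤ α :=
  (isIntegral_algHom_iff τ.toIntAlgHom τ.injective).1 hα.1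

/-- A set of letters that is closed under an irreducible substitution is empty or contains every
letter. -/
lemma Substitution.eq_univ_of_closed (hσ : σ.IsIrreduciblePisot (τ α))
    (hv : σ.IsPosLeftEigenvector τ α v) (S : Set A) (hS : S.Nonempty)
    (hcl : ∀ b ∈ S, ∀ a ∈ σ.image b, a ∈ S) : S = Set.univ := by
  classical
  set M : Matrix A A ℚ := σ.incidence.map (fun m : ℕ => (m : ℚ)) with hM
  let N : Matrix S S ℚ := M.submatrix (↑) (↑)
  -- Columns of `M` indexed by `S` are supported on `S`, so `v` restricted to `S` is a left
  -- eigenvector of the block `N`. The irreducible polynomial of degree `|A|` then divides one of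
  -- degree `|S|`.
  have hdet : N.charpoly.aeval α = 0 := by
    rw [Polynomial.aeval_def, Polynomial.eval₂_eq_eval_map, ← Matrix.charpoly_map,
      Matrix.eval_charpoly, ← Matrix.exists_vecMul_eq_zero_iff]
    refine ⟨fun a => v a, ?_, ?_⟩
    · obtain ⟨a, ha⟩ := hS
      intro h
      have := hv.2 a
      rw [show v a = 0 from congrFun h ⟨a, ha⟩] at this
      simp at this
    · ext ⟨b, hb⟩
      have h := congrFun hv.1 b
      rw [Matrix.vecMul_sub, Pi.sub_apply, Matrix.scalar_apply, Matrix.vecMul_diagonal,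
        Pi.zero_apply, sub_eq_zero, mul_comm]
      rw [Pi.smul_apply, smul_eq_mul] at h
      rw [← h]
      simp only [Matrix.vecMul, dotProduct, Matrix.map_apply, N, Matrix.submatrix_apply, M]
      rw [← Finset.sum_subset (Finset.subset_univ (Finset.univ.filter (· ∈ S)))]
      · rw [Finset.sum_subtype (p := (· ∈ S)) (F := inferInstance) _ (by simp)]
        simp
      · intro a _ ha
        have : a ∉ σ.image b := fun h => ha (by simpa using hcl b hb a h)
        simp [incidence, abel, List.count_eq_zero.2 this]
  have hroot : σ.charpoly.aeval α = 0 := by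
    have h := hσ.2.1.1
    rw [show τ α = τ.toRatAlgHom α from rfl, Polynomial.aeval_algHom_apply] at h
    exact τ.injective (h.trans (map_zero τ).symm)
  have hmin : minpoly ℚ α = σ.charpoly :=
    (minpoly.eq_of_irreducible_of_monic hσ.1 hroot (Matrix.charpoly_monic _)).symm
  have hdvd : σ.charpoly ∣ N.charpoly := hmin ▸ minpoly.dvd ℚ α hdet
  have hdeg := Polynomial.natDegree_le_of_dvd hdvd (Matrix.charpoly_monic _).ne_zero
  rw [Substitution.charpoly, Matrix.charpoly_natDegree_eq_dim,
    Matrix.charpoly_natDegree_eq_dim] at hdeg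
  rw [← Set.toFinset_eq_univ, ← Finset.card_eq_iff_eq_univ, Set.toFinset_card]
  exact le_antisymm (Fintype.card_subtype_le _) hdeg

end Irreducible

/-! ### Integers of the numeration -/

section Integers

variable {σ : Substitution A} {τ : K →+* ℝ} {α : K} {v : A → K}

omit [NumberField K] in
lemma Substitution.exists_pathSums_of_firstLetter (f : A → A)
    (hf : ∀ b, ∃ s, σ.image b = f b :: s) (n : ℕ) (b : A) :
    (0 : K) ∈ σ.pathSums α v n (f^[n] b) b := by
  induction n generalizing b with
  | zero => exact ⟨rfl, rfl⟩
  | succ n ih =>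
    refine ⟨f b, [], ?_, 0, ih (f b), by simp [delta_nil]⟩
    obtain ⟨s, hs⟩ := hf b
    exact ⟨s, by simpa using hs⟩

omit [Fintype A] [DecidableEq A] in
lemma Substitution.exists_firstLetter (σ : Substitution A) :
    ∃ f : A → A, ∀ b, ∃ s, σ.image b = f b :: s := by
  have : ∀ b, ∃ c s, σ.image b = c :: s := fun b => List.exists_cons_of_ne_nil (σ.image_ne_nil b)
  choose f hf using this
  exact ⟨f, hf⟩

omit [Fintype A] [DecidableEq A] in
lemma exists_mem_range_iterate [Finite A] [Nonempty A] (f : A → A) :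
    ∃ c, ∀ n, ∃ b, f^[n] b = c := by
  obtain ⟨b⟩ := ‹Nonempty A›
  obtain ⟨i, j, hij, h⟩ : ∃ i j, i < j ∧ f^[i] b = f^[j] b := by
    obtain ⟨i, j, hne, h⟩ := Finite.exists_ne_map_eq_of_infinite fun n : ℕ => f^[n] b
    rcases hne.lt_or_gt with hlt | hlt
    · exact ⟨i, j, hlt, h⟩
    · exact ⟨j, i, hlt, h.symm⟩
  refine ⟨f^[i] b, fun n => ?_⟩
  have hper : Function.IsPeriodicPt f (j - i) (f^[i] b) := by
    rw [Function.IsPeriodicPt, Function.IsFixedPt, ← Function.iterate_add_apply,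
      Nat.sub_add_cancel hij.le, h]
  have h1 : n ≤ (j - i) * n := Nat.le_mul_of_pos_left _ (Nat.sub_pos_of_lt hij)
  -- With `n` further iterations the total is a multiple of the period.
  refine ⟨f^[(j - i) * n - n] (f^[i] b), ?_⟩
  rw [← Function.iterate_add_apply, Nat.add_sub_cancel' h1]
  exact hper.mul_const n

omit [NumberField K] in
/-- The value `0` occurs in all approximations of the `(σ, c)`-integers for some letter `c`. -/
lemma Substitution.exists_zero_mem_pathSums [Nonempty A] (σ : Substitution A) (α : K) (v : A → K) :
    ∃ c, ∀ k, ∃ e, 0 ∈ σ.pathSums α v k c e := by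
  obtain ⟨f, hf⟩ := σ.exists_firstLetter
  obtain ⟨c, hc⟩ := exists_mem_range_iterate f
  refine ⟨c, fun k => ?_⟩
  obtain ⟨e, rfl⟩ := hc k
  exact ⟨e, exists_pathSums_of_firstLetter f hf k e⟩

/-- Every letter `b` has a value that occurs in all late approximations of the
`(σ, b)`-integers. -/
lemma Substitution.exists_eventually_mem_pathSums (hσ : σ.IsIrreduciblePisot (τ α))
    (hv : σ.IsPosLeftEigenvector τ α v) (b : A) :
    ∃ z, ∀ᶠ k in atTop, ∃ c, z ∈ σ.pathSums α v k b c := by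
  have : Nonempty A := ⟨b⟩
  obtain ⟨c, hc⟩ := σ.exists_zero_mem_pathSums α v
  have huniv : {a | ∃ m D, D ∈ σ.pathSums α v m a c} = Set.univ := by
    refine eq_univ_of_closed hσ hv _ ⟨c, 0, 0, rfl, rfl⟩ ?_
    rintro d ⟨m, D, hD⟩ a ha
    obtain ⟨p, s, hps⟩ := List.append_of_mem ha
    exact ⟨_, _, pathSums_concat (Edge.mem_pathSums ⟨s, hps⟩) hD⟩
  obtain ⟨m, D, hD⟩ : b ∈ {a | ∃ m D, D ∈ σ.pathSums α v m a c} := huniv ▸ Set.mem_univ b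
  refine ⟨D, eventually_atTop.2 ⟨m, fun k hk => ?_⟩⟩
  obtain ⟨e, he⟩ := hc (k - m)
  have h := pathSums_concat hD he
  rw [Nat.add_sub_cancel' hk, mul_zero, add_zero] at h
  exact ⟨e, h⟩

omit [NumberField K] in
lemma Substitution.mem_integers_of_eventually (hα : α ≠ 0) {a : A} {x : K}
    (h : ∀ᶠ k in atTop, ∃ b, x ∈ σ.pathSums α v k a b) : x ∈ σ.integers τ α v a := by
  intro U hU
  filter_upwards [h] with k hk
  exact ⟨τ x, ⟨x, (mem_approxIntegers hα).2 hk, rfl⟩, mem_of_mem_nhds hU⟩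

omit [NumberField K] in
/-- The values of words with real value at most `R` form a finite set. -/
lemma finite_natCombinations_le (hpos : ∀ a, 0 < τ (v a)) (R : ℝ) :
    {x : K | (∃ n : A → ℕ, x = ∑ a, (n a : K) * v a) ∧ τ x ≤ R}.Finite := by
  refine ((Set.finite_Iic (fun a => ⌊R / τ (v a)⌋₊)).image
    fun n : A → ℕ => ∑ a, (n a : K) * v a).subset ?_
  rintro x ⟨⟨n, rfl⟩, hx⟩
  refine ⟨n, fun a => ?_, rfl⟩
  refine Nat.le_floor ((le_div_iff₀ (hpos a)).2 (le_trans ?_ hx))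
  simp only [map_sum, map_mul, map_natCast]
  exact Finset.single_le_sum (f := fun a => (n a : ℝ) * τ (v a))
    (fun b _ => mul_nonneg (Nat.cast_nonneg _) (hpos b).le) (Finset.mem_univ a)

omit [NumberField K] in
lemma Substitution.pathSums_eq_natCombination (hev : ∀ b, α * v b = delta v (σ.image b))
    {n : ℕ} {a b : A} {D : K} (hD : D ∈ σ.pathSums α v n a b) :
    ∃ m : A → ℕ, D = ∑ a, (m a : K) * v a := by
  -- Since `α δ(p) = δ(σ(p))`, powers of `α` are absorbed into words.
  have hmul : ∀ (n : ℕ) (p : List A), ∃ w : List A, α ^ n * delta v p = delta v w := by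
    have h1 : ∀ p : List A, α * delta v p = delta v (σ.apply p) := by
      intro p
      induction p with
      | nil => simp [delta_nil, apply]
      | cons b p ih =>
        rw [delta_cons, mul_add, ih, hev, apply, apply, List.flatMap_cons, delta_append]
    intro n p
    induction n with
    | zero => exact ⟨p, by simp⟩
    | succ n ih =>
      obtain ⟨w, hw⟩ := ih
      exact ⟨σ.apply w, by rw [← h1, ← hw]; ring⟩
  have : ∃ w : List A, D = delta v w := by
    induction n generalizing b D with
    | zero => exact ⟨[], by simp [delta_nil, hD.1]⟩
    | succ n ih =>
      obtain ⟨c, p, -, E, hE, rfl⟩ := hD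
      obtain ⟨w, rfl⟩ := ih hE
      obtain ⟨u, hu⟩ := hmul n p
      exact ⟨w ++ u, by rw [hu, delta_append]⟩
  obtain ⟨w, rfl⟩ := this
  exact ⟨abel w, rfl⟩

omit [NumberField K] in
-- All approximations lie in a locally finite subset of the line, so a limit point must eventually
-- be attained. This reduces the Kuratowski limit to eventual membership.
lemma Substitution.eventually_of_mem_integers (hα : α ≠ 0) (hpos : ∀ a, 0 < τ (v a))
    (hev : ∀ b, α * v b = delta v (σ.image b)) {a : A} {x : K}
    (hx : x ∈ σ.integers τ α v a) : ∀ᶠ k in atTop, ∃ b, x ∈ σ.pathSums α v k a b := by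
  set F := {y : K | (∃ n : A → ℕ, y = ∑ a, (n a : K) * v a) ∧ τ y ≤ τ x + 1} with hF
  have hfin : (τ '' F \ {τ x}).Finite :=
    ((finite_natCombinations_le hpos (τ x + 1)).image τ).subset Set.sdiff_subset
  -- A neighbourhood that meets the values of words in `τ x` at most.
  have hU : (τ '' F \ {τ x})ᶜ ∩ Set.Iio (τ x + 1) ∈ 𝓝 (τ x) :=
    inter_mem (hfin.isClosed.isOpen_compl.mem_nhds (by simp)) (Iio_mem_nhds (by linarith))
  filter_upwards [hx _ hU] with k hk
  obtain ⟨_, ⟨y, hy, rfl⟩, h1, h2⟩ := hk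
  obtain ⟨b, hb⟩ := (mem_approxIntegers hα).1 hy
  have hyx : τ y = τ x := by
    by_contra hne
    exact h1 ⟨⟨y, ⟨pathSums_eq_natCombination hev hb, le_of_lt h2⟩, rfl⟩, hne⟩
  rw [← τ.injective hyx]
  exact ⟨b, hb⟩

end Integers

/-! ### Denominators -/

section Denominators

variable {α : K} {v : A → K}

omit [DecidableEq A] in
lemma exists_int_mul_isIntegral (v : A → K) :
    ∃ N : ℤ, N ≠ 0 ∧ ∀ a, IsIntegral ℤ ((N : K) * v a) := by
  classical
  obtain ⟨N, hN, h⟩ := exists_integral_multiples ℤ ℚ (Finset.univ.image v)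
  exact ⟨N, hN, fun a => by simpa using h (v a) (by simp)⟩

omit [DecidableEq A] [NumberField K] in
lemma isIntegral_mul_natCombination {c : K} (hc : ∀ a, IsIntegral ℤ (c * v a)) (m : A → ℕ) :
    IsIntegral ℤ (c * ∑ a, (m a : K) * v a) := by
  rw [Finset.mul_sum]
  refine IsIntegral.sum _ fun a _ => ?_
  rw [mul_left_comm]
  exact (isIntegral_natCast (m a)).mul (hc a)

omit [Fintype A] [DecidableEq A] [NumberField K] in
lemma mem_fracModule (a : A) : v a ∈ fracModule α v := by
  rw [← mul_one (v a)]
  exact Submodule.mul_mem_mul (Submodule.subset_span ⟨a, rfl⟩)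
    ((Subalgebra.mem_toSubmodule _).2 (one_mem _))

omit [NumberField K] in
lemma delta_mem_fracModule (p : List A) : delta v p ∈ fracModule α v :=
  Submodule.sum_mem _ fun a _ => by
    rw [← nsmul_eq_mul]
    exact nsmul_mem (mem_fracModule a) _

omit [Fintype A] [DecidableEq A] [NumberField K] in
lemma inv_mul_mem_fracModule {x : K} (hx : x ∈ fracModule α v) : α⁻¹ * x ∈ fracModule α v := by
  induction hx using Submodule.mul_induction_on' with
  | mem_mul_mem y hy q hq =>
    rw [mul_left_comm]
    exact Submodule.mul_mem_mul hy 
      ((Subalgebra.mem_toSubmodule _).2 (mul_mem (Algebra.subset_adjoin rfl) hq))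
  | add y _ z _ hy hz => rw [mul_add]; exact add_mem hy hz

omit [Fintype A] [DecidableEq A] [NumberField K] in
lemma inv_pow_mul_mem_fracModule (n : ℕ) {x : K} (hx : x ∈ fracModule α v) :
    α⁻¹ ^ n * x ∈ fracModule α v := by
  induction n with
  | zero => simpa using hx
  | succ n ih =>
    rw [pow_succ', mul_assoc]
    exact inv_mul_mem_fracModule ih

omit [NumberField K] in
lemma mul_mem_fracModule {σ : Substitution A} (hev : ∀ b, α * v b = delta v (σ.image b)) {x : K}
    (hx : x ∈ fracModule α v) : α * x ∈ fracModule α v := by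
  induction hx using Submodule.mul_induction_on' with
  | mem_mul_mem y hy q hq =>
    rw [← mul_assoc]
    refine Submodule.mul_mem_mul ?_ hq
    induction hy using Submodule.span_induction with
    | mem y hy =>
      obtain ⟨b, rfl⟩ := hy
      rw [hev]
      exact Submodule.sum_mem _ fun a _ => by
        rw [← nsmul_eq_mul]
        exact nsmul_mem (Submodule.subset_span (Set.mem_range_self a)) _
    | zero => simp
    | add y z _ _ hy hz => rw [mul_add]; exact add_mem hy hz
    | smul n y _ hy => rw [mul_smul_comm]; exact Submodule.smul_mem _ _ hy
  | add y _ z _ hy hz => rw [mul_add]; exact add_mem hy hz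

omit [Fintype A] [DecidableEq A] [NumberField K] in
-- Beyond the fixed denominator of `v`, only powers of `α` occur in denominators; they are
-- controlled by the finite places of `K_σ`.
lemma exists_pow_mul_isIntegral (hα0 : α ≠ 0) (hα : IsIntegral ℤ α) {c : K}
    (hc : ∀ a, IsIntegral ℤ (c * v a)) {x : K} (hx : x ∈ fracModule α v) :
    ∃ m : ℕ, IsIntegral ℤ (α ^ m * (c * x)) := by
  have hadd : ∀ y z : K, (∃ m : ℕ, IsIntegral ℤ (α ^ m * y)) → (∃ m : ℕ, IsIntegral ℤ (α ^ m * z)) →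
      ∃ m : ℕ, IsIntegral ℤ (α ^ m * (y + z)) := by
    rintro y z ⟨m, hm⟩ ⟨n, hn⟩
    refine ⟨m + n, ?_⟩
    rw [show α ^ (m + n) * (y + z) = α ^ n * (α ^ m * y) + α ^ m * (α ^ n * z) by ring]
    exact ((hα.pow n).mul hm).add ((hα.pow m).mul hn)
  have hadj : ∀ q ∈ Algebra.adjoin ℤ {α⁻¹}, ∃ m : ℕ, IsIntegral ℤ (α ^ m * q) := by
    intro q hq
    induction hq using Algebra.adjoin_induction with
    | mem q hq =>
      obtain rfl := hq
      exact ⟨1, by simpa [hα0] using isIntegral_one⟩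
    | algebraMap n => exact ⟨0, by simpa using isIntegral_intCast n⟩
    | add y z _ _ hy hz => exact hadd y z hy hz
    | mul y z _ _ hy hz =>
      obtain ⟨m, hm⟩ := hy
      obtain ⟨n, hn⟩ := hz
      refine ⟨m + n, ?_⟩
      rw [show α ^ (m + n) * (y * z) = (α ^ m * y) * (α ^ n * z) by ring]
      exact hm.mul hn
  have hspan : ∀ y ∈ Submodule.span ℤ (Set.range v), IsIntegral ℤ (c * y) := by
    intro y hy
    induction hy using Submodule.span_induction with
    | mem y hy => obtain ⟨a, rfl⟩ := hy; exact hc a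
    | zero => simpa using isIntegral_zero
    | add y z _ _ hy hz => rw [mul_add]; exact hy.add hz
    | smul n y _ hy => rw [mul_smul_comm]; exact hy.smul n
  induction hx using Submodule.mul_induction_on' with
  | mem_mul_mem y hy q hq =>
    obtain ⟨m, hm⟩ := hadj q hq
    refine ⟨m, ?_⟩
    rw [show α ^ m * (c * (y * q)) = (c * y) * (α ^ m * q) by ring]
    exact (hspan y hy).mul hm
  | add y _ z _ hy hz => rw [mul_add]; exact hadd _ _ hy hz

lemma valuation_le_one_of_isIntegral {x : K} (hx : IsIntegral ℤ x) (p : HeightOneSpectrum (𝓞 K)) :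
    p.valuation K x ≤ 1 :=
  p.valuation_le_one (⟨x, hx⟩ : 𝓞 K)

/-- An element with denominators only at the primes dividing `α` is an integer if it is
integral at these primes. -/
lemma isIntegral_of_pow_mul {x : K} {m : ℕ} (hα : IsIntegral ℤ α)
    (hm : IsIntegral ℤ (α ^ m * x))
    (h : ∀ p : HeightOneSpectrum (𝓞 K), p.valuation K α < 1 → p.valuation K x ≤ 1) :
    IsIntegral ℤ x := by
  obtain ⟨y, rfl⟩ := HeightOneSpectrum.mem_integers_of_valuation_le_one (R := 𝓞 K) K x fun p => by
    by_cases hp : p.valuation K α < 1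
    · exact h p hp
    · have h1 := le_antisymm (valuation_le_one_of_isIntegral hα p) (not_lt.1 hp)
      simpa [h1] using valuation_le_one_of_isIntegral hm p
  exact y.2

end Denominators

/-! ### The representation space -/

section RepSpace

variable {τ : K →+* ℝ} {α : K}

omit [NumberField K] in
lemma norm_algebraMap_completion (w : InfinitePlace K) (x : K) :
    ‖algebraMap K w.Completion x‖ = w x :=
  InfinitePlace.Completion.norm_coe w (WithAbs.toAbs _ x)

lemma valued_algebraMap_adicCompletion (p : HeightOneSpectrum (𝓞 K)) (x : K) :
    Valued.v (algebraMap K (p.adicCompletion K) x) = p.valuation K x :=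
  HeightOneSpectrum.valuedAdicCompletion_eq_valuation' p x

lemma finite_primes_dividing (hα0 : α ≠ 0) :
    Finite {p : HeightOneSpectrum (𝓞 K) // p.valuation K α < 1} := by
  refine (HeightOneSpectrum.Support.finite (𝓞 K) α⁻¹).subset fun p hp => ?_
  have h0 : 0 < p.valuation K α := zero_lt_iff.2 ((map_ne_zero _).2 hα0)
  change 1 < p.valuation K α⁻¹
  rw [map_inv₀]
  exact (one_lt_inv₀ h0).2 hp

/-- The elements of `K` whose images lie in a suitable neighbourhood of `0` are bounded by `1` at
all places of the representation space. -/
lemma exists_nhds_zero_bounded (hα0 : α ≠ 0) :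
    ∃ U ∈ 𝓝 (0 : RepSpace τ α), ∀ x : K, Phi' τ α x ∈ U →
      (∀ w : InfinitePlace K, w ≠ pisotPlace τ → w x ≤ 1) ∧
      ∀ p : HeightOneSpectrum (𝓞 K), p.valuation K α < 1 → p.valuation K x ≤ 1 := by
  have := finite_primes_dividing (K := K) hα0
  let U₁ : Set (∀ w : {w : InfinitePlace K // w ≠ pisotPlace τ}, w.1.Completion) :=
    Set.univ.pi fun _ => Metric.closedBall 0 1
  let U₂ : Set (∀ p : {p : HeightOneSpectrum (𝓞 K) // p.valuation K α < 1},
      p.1.adicCompletion K) := Set.univ.pi fun _ => {y | Valued.v y ≤ 1}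
  refine ⟨U₁ ×ˢ U₂, prod_mem_nhds ?_ ?_, fun x hx => ⟨fun w hw => ?_, fun p hp => ?_⟩⟩
  · exact set_pi_mem_nhds Set.finite_univ fun w _ => Metric.closedBall_mem_nhds _ one_pos
  · exact set_pi_mem_nhds Set.finite_univ fun p _ =>
      (Valued.isOpen_integer _).mem_nhds (by simp)
  · have h := hx.1 ⟨w, hw⟩ (Set.mem_univ _)
    rw [mem_closedBall_zero_iff] at h
    exact (norm_algebraMap_completion w x).symm.trans_le h
  · have h := hx.2 ⟨p, hp⟩ (Set.mem_univ _)
    exact (valued_algebraMap_adicCompletion p x).symm.trans_le h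

/-- Contraction holds at the infinite places by the Pisot property and at the finite ones by the
choice of primes. -/
lemma tendsto_Phi'_pow (hw : ∀ w : InfinitePlace K, w ≠ pisotPlace τ → w α < 1) :
    Tendsto (fun n : ℕ => Phi' τ α (α ^ n)) atTop (𝓝 0) := by
  refine Prod.tendsto_iff _ _ |>.2 ⟨tendsto_pi_nhds.2 fun w => ?_, tendsto_pi_nhds.2 fun p => ?_⟩
  · change Tendsto (fun n : ℕ => algebraMap K w.1.Completion (α ^ n)) atTop (𝓝 0)
    simp only [map_pow]
    refine tendsto_pow_atTop_nhds_zero_of_norm_lt_one ?_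
    rw [norm_algebraMap_completion]
    exact hw w.1 w.2
  · change Tendsto (fun n : ℕ => algebraMap K (p.1.adicCompletion K) (α ^ n)) atTop (𝓝 0)
    simp only [map_pow]
    refine Valued.tendsto_zero_pow_of_v_lt_one ?_
    rw [valued_algebraMap_adicCompletion]
    exact p.2

/-- Elements of `K` with bounded denominators and bounded conjugates form a finite set. -/
lemma finite_of_bounded {c : K} (hc : c ≠ 0) (B C : ℝ) :
    {x : K | IsIntegral ℤ (c * x) ∧ (0 ≤ τ x ∧ τ x < B) ∧
      ∀ w : InfinitePlace K, w ≠ pisotPlace τ → w x ≤ C}.Finite := by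
  obtain ⟨E, hE⟩ : ∃ E : ℝ, ∀ w : InfinitePlace K, w c ≤ E := by
    obtain ⟨E, hE⟩ := (Set.finite_range fun w : InfinitePlace K => w c).bddAbove
    exact ⟨E, fun w => hE ⟨w, rfl⟩⟩
  refine Set.Finite.of_finite_image (f := fun x => c * x)
    ((Embeddings.finite_of_norm_le K ℂ (E * max B C)).subset ?_) (mul_right_injective₀ hc).injOn
  rintro _ ⟨x, ⟨hint, ⟨h0, hB⟩, hC⟩, rfl⟩
  refine ⟨hint, fun φ => ?_⟩
  rw [map_mul, norm_mul]
  have h1 : ‖φ c‖ ≤ E := hE (InfinitePlace.mk φ)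
  have h2 : ‖φ x‖ ≤ max B C := by
    change (InfinitePlace.mk φ) x ≤ _
    by_cases h : InfinitePlace.mk φ = pisotPlace τ
    · rw [h]
      refine le_max_of_le_left ?_
      change ‖((τ x : ℝ) : ℂ)‖ ≤ B
      rw [Complex.norm_real, Real.norm_of_nonneg h0]
      exact hB.le
    · exact le_max_of_le_right (hC _ h)
  exact mul_le_mul h1 h2 (norm_nonneg _) ((norm_nonneg _).trans h1)

end RepSpace

/-! ### Bounds for digit sums and orbits -/

section Bounds

variable {σ : Substitution A} {τ : K →+* ℝ} {α : K} {v : A → K}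

omit [NumberField K] in
/-- A bound for the digits at an infinite place. -/
lemma Substitution.Edge.infinitePlace_delta_le (w : InfinitePlace K) {a b : A} {p : List A}
    (h : σ.Edge b p a) :
    w (delta v p) ≤ ∑ b, ∑ a, ((σ.image b).count a : ℝ) * w (v a) := by
  obtain ⟨s, hs⟩ := h
  have h1 : w (delta v p) ≤ ∑ a, ((σ.image b).count a : ℝ) * w (v a) := by
    refine (w.1.sum_le _ _).trans (Finset.sum_le_sum fun a _ => ?_)
    change w (_ * _) ≤ _
    rw [map_mul]
    refine mul_le_mul_of_nonneg_right ?_ (apply_nonneg _ _)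
    rw [← InfinitePlace.norm_embedding_eq, map_natCast, Complex.norm_natCast, abel, hs]
    exact Nat.cast_le.2 ((List.sublist_append_left p _).count_le a)
  exact h1.trans (Finset.single_le_sum (f := fun b => ∑ a, ((σ.image b).count a : ℝ) * w (v a))
    (fun b _ => Finset.sum_nonneg fun a _ => mul_nonneg (Nat.cast_nonneg _) (apply_nonneg _ _))
    (Finset.mem_univ b))

lemma exists_digit_bound (σ : Substitution A) (v : A → K) :
    ∃ B : ℝ, 0 ≤ B ∧ ∀ (w : InfinitePlace K) (a b : A) (p : List A), σ.Edge b p a →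
      w (delta v p) ≤ B := by
  obtain ⟨B, hB⟩ := (Set.finite_range fun w : InfinitePlace K =>
    ∑ b, ∑ a, ((σ.image b).count a : ℝ) * w (v a)).bddAbove
  exact ⟨max B 0, le_max_right _ _, fun w a b p h => (h.infinitePlace_delta_le w).trans
    (le_max_of_le_left (hB ⟨w, rfl⟩))⟩

/-- The contraction ratio and the bound for the attractor at the contracting infinite places. -/
lemma exists_ratio (hw : ∀ w : InfinitePlace K, w ≠ pisotPlace τ → w α < 1) :
    ∃ r : ℝ, 0 ≤ r ∧ r < 1 ∧ ∀ w : InfinitePlace K, w ≠ pisotPlace τ → w α ≤ r := by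
  have h : ∀ᶠ r in 𝓝[<] (1 : ℝ), ∀ w : InfinitePlace K, w ≠ pisotPlace τ → w α ≤ r := by
    refine eventually_all.2 fun w => ?_
    by_cases hne : w = pisotPlace τ
    · exact Eventually.of_forall fun r h => absurd hne h
    · filter_upwards [Ioo_mem_nhdsLT (hw w hne)] with r hr _ using hr.1.le
  obtain ⟨r, hr, hr0, hr1⟩ := (h.and (Ioo_mem_nhdsLT zero_lt_one)).exists
  exact ⟨r, hr0.le, hr1, hr⟩

/-- A path sum is dominated by a geometric series in the contraction ratio, so the bound is uniform
in the length. -/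
lemma exists_pathSums_bound (σ : Substitution A) (v : A → K)
    (hw : ∀ w : InfinitePlace K, w ≠ pisotPlace τ → w α < 1) :
    ∃ C : ℝ, ∀ (w : InfinitePlace K), w ≠ pisotPlace τ → ∀ (n : ℕ) (a b : A),
      ∀ D ∈ σ.pathSums α v n a b, w D ≤ C := by
  obtain ⟨B, hB0, hB⟩ := exists_digit_bound σ v
  obtain ⟨r, hr0, hr1, hr⟩ := exists_ratio hw
  refine ⟨B / (1 - r), fun w hne n a b D hD => ?_⟩
  -- The exact partial geometric sum is what makes the induction close.
  have : w D ≤ B / (1 - r) * (1 - r ^ n) := by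
    induction n generalizing b D with
    | zero => simp [hD.1]
    | succ n ih =>
      obtain ⟨c, p, he, E, hE, rfl⟩ := hD
      have h1 := ih _ _ hE
      have h2 := hB w _ _ _ he
      have h3 : w (α ^ n * delta v p) ≤ r ^ n * B := by
        rw [map_mul, map_pow]
        exact mul_le_mul (pow_le_pow_left₀ (apply_nonneg _ _) (hr w hne) n) h2 (apply_nonneg _ _)
          (pow_nonneg hr0 n)
      refine ((w.1.add_le _ _).trans (add_le_add h1 h3)).trans_eq ?_
      have : 1 - r ≠ 0 := by linarith
      field_simp
      ring
  refine this.trans (mul_le_of_le_one_right (div_nonneg hB0 (by linarith)) ?_)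
  linarith [pow_nonneg hr0 n]

end Bounds

/-! ### Property (F) and the exclusive inner point -/

section Main

variable {σ : Substitution A} {τ : K →+* ℝ} {α : K} {v : A → K}

omit [NumberField K] in
lemma Substitution.pathSums_subset_fracModule (hev : ∀ b, α * v b = delta v (σ.image b))
    {n : ℕ} {a b : A} {D : K} (hD : D ∈ σ.pathSums α v n a b) : D ∈ fracModule α v := by
  obtain ⟨m, rfl⟩ := pathSums_eq_natCombination hev hD
  exact Submodule.sum_mem _ fun a _ => by
    rw [← nsmul_eq_mul]
    exact nsmul_mem (mem_fracModule a) _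

/-- The inverse branches of the Dumont-Thomas map preserve the fractional parts. -/
lemma Substitution.frac_backward (hpos : ∀ a, 0 < τ (v a)) (hα : 0 < τ α)
    (hev : ∀ b, α * v b = delta v (σ.image b)) {n : ℕ} {a b : A} {x D : K}
    (hx : x ∈ frac τ α v a) (hD : D ∈ σ.pathSums α v n a b) :
    α⁻¹ ^ n * (x + D) ∈ frac τ α v b := by
  obtain ⟨hx, h0, h1⟩ := hx
  rw [delta_singleton] at h1
  have hn : 0 < τ α ^ n := pow_pos hα n
  have h2 := pathSums_nonneg hpos hα hD
  have h3 := pathSums_add_le hpos hα hev hD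
  have h4 : τ (α⁻¹ ^ n * (x + D)) = (τ x + τ D) / τ α ^ n := by
    simp only [map_mul, map_pow, map_inv₀, map_add, inv_pow, div_eq_inv_mul]
  refine ⟨?_, ?_, ?_⟩
  · exact inv_pow_mul_mem_fracModule n (add_mem hx (pathSums_subset_fracModule hev hD))
  · rw [h4]
    exact div_nonneg (by linarith) hn.le
  · rw [h4, delta_singleton, div_lt_iff₀ hn]
    linarith

omit [NumberField K] in
lemma zero_mem_frac (hpos : ∀ a, 0 < τ (v a)) (a : A) : (0 : K) ∈ frac τ α v a :=
  ⟨zero_mem _, by simp, by simpa [delta_singleton] using hpos a⟩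

/-- The half of (F) that holds regardless of how the tiles meet at `0`. -/
lemma Substitution.iUnion_dualMap_subset (hpos : ∀ a, 0 < τ (v a)) (hα : 0 < τ α)
    (hα0 : α ≠ 0) (hev : ∀ b, α * v b = delta v (σ.image b)) :
    ⋃ m : ℕ, (σ.dualMap (Phi' τ α) α v)^[m] (baseSet A τ α) ⊆ translationSet τ α v := by
  intro g hg
  obtain ⟨m, hm⟩ := Set.mem_iUnion.1 hg
  obtain ⟨⟨γ, a⟩, hγ, D, hD, h⟩ := (mem_iterate_dualMap _ hα0 _ _ _).1 hm
  obtain rfl : γ = 0 := hγ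
  refine ⟨α⁻¹ ^ m * (0 + D), frac_backward hpos hα hev (zero_mem_frac hpos a) hD, ?_⟩
  rw [h, map_mul, map_add, map_zero]

omit [NumberField K] in
/-- If `α ^ m * y` is the value of a path of length `m`, then so is `α ^ n * y` for paths of
length `n ≥ m`. -/
lemma Substitution.pathSums_mono {y : K} {b : A} {m n : ℕ} (hmn : m ≤ n)
    (h : ∃ c, α ^ m * y ∈ σ.pathSums α v m c b) : ∃ c, α ^ n * y ∈ σ.pathSums α v n c b := by
  obtain ⟨c, hc⟩ := h
  obtain ⟨f, hf⟩ := σ.exists_firstLetter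
  have h := pathSums_concat (exists_pathSums_of_firstLetter f hf (n - m) c) hc
  -- The path is extended at its low-order end by zero digits, following first letters.
  rw [Nat.sub_add_cancel hmn, zero_add, ← mul_assoc, ← pow_add, Nat.sub_add_cancel hmn] at h
  exact ⟨_, h⟩

lemma Substitution.GeometricPropertyF.zero_notMem_tile (hF : σ.GeometricPropertyF τ α v)
    (hα : 0 < τ α) (hα0 : α ≠ 0) (hint : IsIntegral ℤ α) (hpos : ∀ a, 0 < τ (v a))
    (hev : ∀ b, α * v b = delta v (σ.image b))
    (hw : ∀ w : InfinitePlace K, w ≠ pisotPlace τ → w α < 1) {a : A} {x : K}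
    (hx : x ∈ frac τ α v a) (hne : Phi' τ α x ≠ 0) : 0 ∉ σ.tile τ α v (Phi' τ α x, a) := by
  rintro ⟨z₀, hz₀, h0 : z₀ + Phi' τ α x = 0⟩
  -- Injectivity of `Phi'` on the field `K` needs a nontrivial target.
  have hnt : Nontrivial (RepSpace τ α) := ⟨_, _, hne⟩
  have hinj := (Phi' τ α).injective
  obtain ⟨N, hN0, hN⟩ := exists_int_mul_isIntegral v
  obtain ⟨C, hC⟩ := exists_pathSums_bound σ v hw
  obtain ⟨U, hU, hUb⟩ := exists_nhds_zero_bounded (τ := τ) hα0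
  -- In the bound, `1` will come from the neighbourhood `U` and `C` from the path sum `F`.
  -- Independence of `M` lets `M` be chosen before `z`.
  let S : Set (K × A) := {s | s.1 ∈ frac τ α v s.2 ∧ IsIntegral ℤ ((N : K) * s.1) ∧
    ∀ w : InfinitePlace K, w ≠ pisotPlace τ → w s.1 ≤ 1 + C}
  have hS : S.Finite := by
    refine (Set.finite_iUnion fun b : A => (finite_of_bounded (τ := τ) (c := (N : K))
      (Int.cast_ne_zero.2 hN0) (τ (v b)) (1 + C)).image fun y => (y, b)).subset ?_
    rintro ⟨y, b⟩ ⟨h1, h2, h3⟩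
    have h4 := h1.2.2
    rw [delta_singleton] at h4
    exact Set.mem_iUnion.2 ⟨b, y, ⟨h2, ⟨h1.2.1, h4⟩, h3⟩, rfl⟩
  have hdeath : ∀ s ∈ S, ∀ᶠ M in atTop, ∃ c, α ^ M * s.1 ∈ σ.pathSums α v M c s.2 := by
    rintro ⟨y, b⟩ ⟨hy, -, -⟩
    have hmem : (Phi' τ α y, b) ∈ translationSet τ α v := ⟨y, hy, rfl⟩
    rw [hF] at hmem
    obtain ⟨m, hm⟩ := Set.mem_iUnion.1 hmem
    obtain ⟨⟨γ, c⟩, hγ, D, hD, h⟩ := (mem_iterate_dualMap _ hα0 _ _ _).1 hm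
    obtain rfl : γ = 0 := hγ
    have h' : y = α⁻¹ ^ m * D := hinj (by simpa using h)
    have h'' : α ^ m * y = D := by
      rw [h', ← mul_assoc, ← mul_pow, mul_inv_cancel₀ hα0, one_pow, one_mul]
    exact eventually_atTop.2 ⟨m, fun M hM => pathSums_mono hM ⟨c, by rw [h'']; exact hD⟩⟩
  obtain ⟨M, hM⟩ := ((eventually_all_finite hS).2 hdeath).exists
  have hV : (fun u => Phi' τ α (α⁻¹ ^ M) * (u + Phi' τ α x)) ⁻¹' U ∈ 𝓝 z₀ := by
    have hcont : Continuous fun u : RepSpace τ α => Phi' τ α (α⁻¹ ^ M) * (u + Phi' τ α x) := by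
      fun_prop
    refine hcont.continuousAt ?_
    simpa [h0] using hU
  obtain ⟨_, hzV, z, hz, rfl⟩ := mem_closure_iff_nhds.1 hz₀ _ hV
  rw [Set.mem_preimage, ← map_add, ← map_mul] at hzV
  obtain ⟨hinf, hfin⟩ := hUb _ hzV
  obtain ⟨k, ⟨b, hzb⟩, hk⟩ :=
    ((eventually_of_mem_integers hα0 hpos hev hz).and (eventually_ge_atTop M)).exists
  rw [← Nat.add_sub_cancel' hk] at hzb
  -- `E` carries the `M` low digits of `z`, and `F` the remaining ones.
  obtain ⟨c, E, hE, F, hFm, rfl⟩ := pathSums_split hzb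
  set y := α⁻¹ ^ M * (x + E) with hy
  have hyfrac : y ∈ frac τ α v c := frac_backward hpos hα hev hx hE
  have hinv : α⁻¹ ^ M * α ^ M = 1 := by rw [← mul_pow, inv_mul_cancel₀ hα0, one_pow]
  have hyeq : y = α⁻¹ ^ M * (E + α ^ M * F + x) - F := by
    rw [hy]
    linear_combination -F * hinv
  have hNF : IsIntegral ℤ ((N : K) * F) := by
    obtain ⟨m, rfl⟩ := pathSums_eq_natCombination hev hFm
    exact isIntegral_mul_natCombination hN m
  have hyS : (y, c) ∈ S := by
    refine ⟨hyfrac, ?_, fun w hne => ?_⟩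
    -- Membership in the module settles the primes not dividing `α`; at those dividing `α`, both
    -- terms of `hyeq` are controlled.
    · obtain ⟨m, hm⟩ := exists_pow_mul_isIntegral hα0 hint hN hyfrac.1
      refine isIntegral_of_pow_mul hint hm fun p hp => ?_
      rw [hyeq, mul_sub]
      refine (Valuation.map_sub _ _ _).trans (max_le ?_ (valuation_le_one_of_isIntegral hNF p))
      rw [map_mul]
      exact mul_le_one' (valuation_le_one_of_isIntegral (isIntegral_intCast N) p) (hfin p hp)
    · change w y ≤ _
      rw [hyeq]
      exact (w.1.sub_le_add _ _).trans (add_le_add (hinf w hne) (hC w hne _ _ _ _ hFm))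
  obtain ⟨d, hd⟩ := hM _ hyS
  have hd' : x + E ∈ σ.pathSums α v M d c := by
    convert hd using 1
    rw [hy]
    linear_combination -(x + E) * hinv
  have hx' := hx.2
  rw [delta_singleton] at hx'
  -- `x + E` is also `0` plus a path sum from the same letter `c`, so `x = 0`.
  obtain ⟨rfl, -⟩ := pathSums_unique hpos hα hev hE hd' hx' (x' := 0) (by simpa using hpos d)
    (by ring)
  simp at hne

lemma Substitution.zero_mem_centralTile [Nonempty A] (hα0 : α ≠ 0) :
    ∃ g ∈ baseSet A τ α, 0 ∈ σ.tile τ α v g := by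
  obtain ⟨c, hc⟩ := σ.exists_zero_mem_pathSums α v
  refine ⟨(0, c), rfl, 0, subset_closure ⟨0, ?_, map_zero _⟩, by simp⟩
  exact mem_integers_of_eventually hα0 (Eventually.of_forall hc)

/-- Every fractional part is reached by the inverse branches from a periodic one. -/
lemma Substitution.exists_periodic (hα : 0 < τ α) (hα0 : α ≠ 0) (hint : IsIntegral ℤ α)
    (hev : ∀ b, α * v b = delta v (σ.image b))
    (hw : ∀ w : InfinitePlace K, w ≠ pisotPlace τ → w α < 1) {a : A} {x : K}
    (hx : x ∈ frac τ α v a) :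
    ∃ b, ∃ y ∈ frac τ α v b, (∃ i, ∃ D ∈ σ.pathSums α v i b a, α ^ i * x = y + D) ∧
      ∃ n, 0 < n ∧ ∀ k, α ^ (n * k) * y - y ∈ σ.pathSums α v (n * k) b b := by
  obtain ⟨N, hN0, hN⟩ := exists_int_mul_isIntegral v
  obtain ⟨m, hm⟩ := exists_pow_mul_isIntegral hα0 hint hN hx.1
  obtain ⟨B, hB0, hB⟩ := exists_digit_bound σ v
  obtain ⟨r, hr0, hr1, hr⟩ := exists_ratio hw
  obtain ⟨E, hE⟩ := (Set.finite_range fun w : InfinitePlace K => w x).bddAbove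
  -- Large enough for the starting point `x` and stable under `t ↦ r t + B`, the effect of one
  -- forward step.
  set C := max E (B / (1 - r)) with hC
  have hCB : r * C + B ≤ C := by
    have h := le_max_right E (B / (1 - r))
    rw [div_le_iff₀ (by linarith), ← hC] at h
    linarith
  -- A common denominator for the whole orbit: it clears `x` and every digit.
  set c : K := α ^ m * N with hc
  have hc0 : c ≠ 0 := mul_ne_zero (pow_ne_zero _ hα0) (Int.cast_ne_zero.2 hN0)
  have hcd : ∀ p, IsIntegral ℤ (c * delta v p) := fun p => by
    rw [hc, mul_assoc]
    exact (hint.pow m).mul (isIntegral_mul_natCombination hN _)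
  let S : Set (K × A) := {s | s.1 ∈ frac τ α v s.2 ∧ IsIntegral ℤ (c * s.1) ∧
    ∀ w : InfinitePlace K, w ≠ pisotPlace τ → w s.1 ≤ C}
  have hS : S.Finite := by
    refine (Set.finite_iUnion fun b : A => (finite_of_bounded (τ := τ) hc0 (τ (v b)) C).image
      fun y => (y, b)).subset ?_
    rintro ⟨y, b⟩ ⟨h1, h2, h3⟩
    have h4 := h1.2.2
    rw [delta_singleton] at h4
    exact Set.mem_iUnion.2 ⟨b, y, ⟨h2, ⟨h1.2.1, h4⟩, h3⟩, rfl⟩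
  have hstep : ∀ s : S, ∃ t : S, ∃ p, σ.Edge s.1.2 p t.1.2 ∧ α * s.1.1 = t.1.1 + delta v p := by
    rintro ⟨⟨y, b⟩, hy, hyi, hyw⟩
    have hy2 := hy.2
    rw [delta_singleton] at hy2
    obtain ⟨d, p, he, h1, h2⟩ := exists_forward hα hev b y hy2
    refine ⟨⟨(α * y - delta v p, d), ⟨?_, h1, by rwa [delta_singleton]⟩, ?_, fun w hne => ?_⟩, p,
      he, by simp⟩
    · exact sub_mem (mul_mem_fracModule hev hy.1) (delta_mem_fracModule p)
    · change IsIntegral ℤ (c * (α * y - delta v p))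
      rw [mul_sub, mul_left_comm]
      exact (hint.mul hyi).sub (hcd p)
    · refine (w.1.sub_le_add _ _).trans (le_trans (add_le_add ?_ (hB w _ _ _ he)) hCB)
      change w (α * y) ≤ _
      rw [map_mul]
      exact mul_le_mul (hr w hne) (hyw w hne) (apply_nonneg _ _) hr0
  choose f p hfe hfp using hstep
  have hiter : ∀ n s, ∃ D ∈ σ.pathSums α v n (f^[n] s).1.2 s.1.2,
      α ^ n * s.1.1 = (f^[n] s).1.1 + D := by
    intro n
    induction n with
    | zero => exact fun s => ⟨0, ⟨rfl, rfl⟩, by simp⟩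
    | succ n ih =>
      intro s
      obtain ⟨D, hD, h⟩ := ih (f s)
      refine ⟨_, ⟨_, p s, hfe s, D, hD, rfl⟩, ?_⟩
      rw [Function.iterate_succ_apply]
      linear_combination α ^ n * hfp s + h
  have : Finite S := hS
  let s₀ : S := ⟨(x, a), hx, by rw [hc, mul_assoc]; exact hm, fun w _ =>
    (hE ⟨w, rfl⟩).trans (le_max_left _ _)⟩
  obtain ⟨i, j, hij, h⟩ : ∃ i j, i < j ∧ f^[i] s₀ = f^[j] s₀ := by
    obtain ⟨i, j, hne, h⟩ := Finite.exists_ne_map_eq_of_infinite fun n : ℕ => f^[n] s₀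
    rcases hne.lt_or_gt with hlt | hlt
    · exact ⟨i, j, hlt, h⟩
    · exact ⟨j, i, hlt, h.symm⟩
  have hper : Function.IsPeriodicPt f (j - i) (f^[i] s₀) := by
    rw [Function.IsPeriodicPt, Function.IsFixedPt, ← Function.iterate_add_apply,
      Nat.sub_add_cancel hij.le, h]
  refine ⟨_, _, (f^[i] s₀).2.1, ⟨i, hiter i s₀⟩, j - i, Nat.sub_pos_of_lt hij, fun k => ?_⟩
  obtain ⟨D, hD, hDe⟩ := hiter ((j - i) * k) (f^[i] s₀)
  rw [(hper.mul_const k).eq] at hD hDe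
  rwa [hDe, add_sub_cancel_left]

/-- The sums over `k` turns around the cycle tend to `-Φ'(y)`, because `α^{nk} y` tends to `0` in
`K_σ`. -/
lemma Substitution.zero_mem_tile_of_periodic (hα0 : α ≠ 0) (hσ : σ.IsIrreduciblePisot (τ α))
    (hv : σ.IsPosLeftEigenvector τ α v)
    (hw : ∀ w : InfinitePlace K, w ≠ pisotPlace τ → w α < 1) {b : A} {y : K} {n : ℕ} (hn : 0 < n)
    (h : ∀ k, α ^ (n * k) * y - y ∈ σ.pathSums α v (n * k) b b) :
    0 ∈ σ.tile τ α v (Phi' τ α y, b) := by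
  -- A finite turn around the cycle need not be an integer of the numeration; adding `α^{nk} z`
  -- makes it occur in all late approximations without changing the limit.
  obtain ⟨z, hz⟩ := exists_eventually_mem_pathSums hσ hv b
  refine ⟨-Phi' τ α y, ?_, by simp⟩
  have hlim : Tendsto (fun k => Phi' τ α (α ^ (n * k) * y - y + α ^ (n * k) * z)) atTop
      (𝓝 (-Phi' τ α y)) := by
    have h1 : Tendsto (fun k : ℕ => n * k) atTop atTop := tendsto_id.const_mul_atTop' hn
    have h2 := (((tendsto_Phi'_pow hw).comp h1).mul_const (Phi' τ α (y + z))).sub_const (Phi' τ α y)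
    rw [zero_mul, zero_sub] at h2
    refine h2.congr fun k => ?_
    simp only [Function.comp, map_add, map_sub, map_mul]
    ring
  refine mem_closure_of_tendsto hlim (Eventually.of_forall fun k => ⟨_, ?_, rfl⟩)
  refine mem_integers_of_eventually hα0 ?_
  obtain ⟨J, hJ⟩ := eventually_atTop.1 hz
  refine eventually_atTop.2 ⟨n * k + J, fun l hl => ?_⟩
  obtain ⟨c, hc⟩ := hJ (l - n * k) (by omega)
  have := pathSums_concat (h k) hc
  rw [Nat.add_sub_cancel' (by omega)] at this
  exact ⟨c, this⟩

end Main

end PisotSubst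

end

theorem mainTheorem6 {A : Type*} [Fintype A] [DecidableEq A] (σ : PisotSubst.Substitution A)
    {K : Type*} [Field K] [NumberField K] (τ : K →+* ℝ) (α : K)
    (hK : IntermediateField.adjoin ℚ {α} = ⊤)
    (hσ : σ.IsIrreduciblePisot (τ α))
    (v : A → K) (hv : σ.IsPosLeftEigenvector τ α v)
    (hcoinc : σ.StrongCoincidence) :
    σ.GeometricPropertyF τ α v ↔ σ.ZeroIsExclusiveInnerPoint τ α v := by
  have hα1 := hσ.2.2.2.1
  have hα : 0 < τ α := zero_lt_one.trans hα1
  have hα0 : α ≠ 0 := fun h => by simp [h] at hα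
  have hint := PisotSubst.isIntegral_of_isPisotNumber hσ.2.2
  have hev := PisotSubst.Substitution.mul_eq_delta_image hv
  have hw := fun (w : NumberField.InfinitePlace K) (h : w ≠ PisotSubst.pisotPlace τ) =>
    PisotSubst.infinitePlace_lt_one hK hσ.2.2 h
  have hA : Nonempty A := by
    have h := hσ.1.natDegree_pos
    rw [PisotSubst.Substitution.charpoly, Matrix.charpoly_natDegree_eq_dim] at h
    exact Fintype.card_pos_iff.1 h
  constructor
  · intro hF
    refine ⟨PisotSubst.Substitution.zero_mem_centralTile hα0, ?_⟩
    rintro ⟨γ, a⟩ ⟨x, hx, hγ⟩ hne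
    obtain rfl : γ = PisotSubst.Phi' τ α x := hγ
    exact hF.zero_notMem_tile hα hα0 hint hv.2 hev hw hx hne
  · intro hE
    refine Set.Subset.antisymm ?_
      (PisotSubst.Substitution.iUnion_dualMap_subset hv.2 hα hα0 hev)
    rintro ⟨γ, a⟩ ⟨x, hx, hγ⟩
    obtain rfl : γ = PisotSubst.Phi' τ α x := hγ
    obtain ⟨b, y, hy, ⟨i, D, hD, hxD⟩, n, hn, hper⟩ :=
      PisotSubst.Substitution.exists_periodic hα hα0 hint hev hw hx
    -- The tile of `y` contains `0`, so exclusivity puts its index in the base set.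
    have hy0 : PisotSubst.Phi' τ α y = 0 := by
      by_contra hne
      exact hE.2 (PisotSubst.Phi' τ α y, b) ⟨y, hy, rfl⟩ hne
        (PisotSubst.Substitution.zero_mem_tile_of_periodic hα0 hσ hv hw hn hper)
    refine Set.mem_iUnion.2 ⟨i, (PisotSubst.Substitution.mem_iterate_dualMap _ hα0 _ _ _).2
      ⟨(PisotSubst.Phi' τ α y, b), hy0, D, hD, ?_⟩⟩
    change PisotSubst.Phi' τ α x = _
    rw [← map_add, ← map_mul, ← hxD, ← mul_assoc, ← mul_pow, inv_mul_cancel₀ hα0, one_pow, one_mul]
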